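/- Let $H$ be an infinite-dimensional separable complex Hilbert space, and let $P_\infty(H)$ be the set of all orthogonal projections on $H$ whose image and kernel are both infinite-dimensional. For unit vectors $x,y\in H$ put $\angle(x,y)=\arccos|\langle x,y\rangle|\in[0,\pi/2]$. Let $\phi:P_\infty(H)\to P_\infty(H)$ be a surjective map such that $$\inf\{\angle(x,y): x\in\operatorname{Im}P,\ y\in\operatorname{Im}Q,\ \|x\|=\|y\|=1\}=\inf\{\angle(x,y): x\in\operatorname{Im}\phi(P),\ y\in\operatorname{Im}\phi(Q),\ \|x\|=\|y\|=1\}$$ for all $P,Q\in P_\infty(H)$. Then there exists a unitary or antiunitary operator $U:H\to H$ such that $\phi(P)=UPU^*$ for all $P\in P_\infty(H)$. Here an antiunitary operator is a surjective conjugate-linear map $U$ with $\langle Ux,Uy\rangle=\langle y,x\rangle$ for all $x,y\in H$, and its adjoint $U^*$ is the conjugate-linear map determined by $\langle Ux,y\rangle=\langle U^*y,x\rangle$ for all $x,y\in H$. -/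

import Mathlib

open scoped InnerProductSpace ComplexConjugate

section Definitions

variable {H : Type*} [NormedAddCommGroup H] [InnerProductSpace ℂ H]

/-- The angle `arccos |⟨x, y⟩|` between two unit vectors; it lies in `[0, π / 2]`. -/
noncomputable def unitAngle (x y : H) : ℝ :=
  Real.arccos ‖⟪x, y⟫_ℂ‖

/-- The set of all angles between unit vectors `x ∈ Im P` and `y ∈ Im Q`. -/
def imageAngles (P Q : H →L[ℂ] H) : Set ℝ :=
  {t | ∃ x ∈ P.range, ∃ y ∈ Q.range, ‖x‖ = 1 ∧ ‖y‖ = 1 ∧ unitAngle x y = t}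

/-- The infimal angle between the images of `P` and `Q`. -/
noncomputable def infAngle (P Q : H →L[ℂ] H) : ℝ :=
  sInf (imageAngles P Q)

/-- The infimum is a genuine one: all the angles are nonnegative. -/
theorem imageAngles_bddBelow (P Q : H →L[ℂ] H) : BddBelow (imageAngles P Q) :=
  ⟨0, by rintro t ⟨x, -, y, -, -, -, rfl⟩; exact Real.arccos_nonneg _⟩

/-- The infimum is a genuine one: for nonzero operators there are such angles. -/
theorem imageAngles_nonempty {P Q : H →L[ℂ] H} (hP : P ≠ 0) (hQ : Q ≠ 0) :
    (imageAngles P Q).Nonempty := by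
  have key : ∀ T : H →L[ℂ] H, T ≠ 0 → ∃ x ∈ T.range, ‖x‖ = 1 := by
    intro T hT
    obtain ⟨v, hv⟩ : ∃ v, T v ≠ 0 := by
      by_contra! h
      exact hT (ContinuousLinearMap.ext h)
    exact ⟨((‖T v‖ : ℂ)⁻¹) • T v, Submodule.smul_mem _ _ ⟨v, rfl⟩, norm_smul_inv_norm hv⟩
  obtain ⟨x, hx, hx1⟩ := key P hP
  obtain ⟨y, hy, hy1⟩ := key Q hQ
  exact ⟨_, x, hx, y, hy, hx1, hy1, rfl⟩

variable (H) in
/-- The set `P_∞(H)` of all (orthogonal) projections on `H` whose image and kernel are both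
infinite-dimensional. -/
def ProjInf [CompleteSpace H] : Set (H →L[ℂ] H) :=
  {P | IsStarProjection P ∧ ¬ FiniteDimensional ℂ P.range ∧ ¬ FiniteDimensional ℂ P.ker}

/-- Antiunitary operators: surjective conjugate-linear maps `U` with `⟨U x, U y⟩ = ⟨y, x⟩`. -/
structure IsAntiunitary (U : H →L⋆[ℂ] H) : Prop where
  surjective : Function.Surjective U
  inner_map_map : ∀ x y : H, ⟪U x, U y⟫_ℂ = ⟪y, x⟫_ℂ

/-- The adjoint `U*` of a bounded conjugate-linear operator `U`: the vector `U* y` represents the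
bounded linear functional `x ↦ conj ⟨y, U x⟩ = ⟨U x, y⟩`, so that `⟨U x, y⟩ = ⟨U* y, x⟩`. -/
noncomputable def conjAdjoint [CompleteSpace H] (U : H →L⋆[ℂ] H) : H →L⋆[ℂ] H :=
  ((InnerProductSpace.toDual ℂ H).symm : StrongDual ℂ H →L⋆[ℂ] H).comp
    ((ContinuousLinearMap.compSL H H ℂ (starRingEnd ℂ) (starRingEnd ℂ)).flip U |>.comp
      (innerSLFlip ℂ : H →L[ℂ] H →L⋆[ℂ] ℂ))

/-- The defining property of the adjoint of a bounded conjugate-linear operator. -/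
theorem inner_conjAdjoint [CompleteSpace H] (U : H →L⋆[ℂ] H) (x y : H) :
    ⟪conjAdjoint U y, x⟫_ℂ = ⟪U x, y⟫_ℂ := by
  simp [conjAdjoint]

end Definitions

/-! ### Infinite-dimensional subspaces and the members of $P_\infty(H)$ built from orthonormal
sequences. -/

section Grassmannian

variable {H : Type*} [NormedAddCommGroup H] [InnerProductSpace ℂ H]

/-! The angle is $\pi/2$ exactly when the images are orthogonal, so $\phi$ preserves orthogonality
in both directions. Inclusion and complementation of images are definable from orthogonality, and
surjectivity carries them through $\phi$ (`im_le_iff`, `im_compl`).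

Lines are not images of members of $P_\infty(H)$, but they are differences of such images: for a
unit vector $x\perp\operatorname{Im}A$ let $M$ be $A$ with $x$ adjoined. Nothing lies strictly
between $A$ and $M$, so $\operatorname{Im}\phi(M)\ominus\operatorname{Im}\phi(A)$ is a line
$\mathbb{C}t$ (`exists_span_eq_increment`). This line depends only on $x$: it is unchanged when $A$
grows by an infinite-dimensional piece, and such inclusions connect any two choices of $A$
(`exists_chain`, `increment_eq`).

If $A\perp B$ are both orthogonal to $x$ and $y$, the angle between $A\oplus\mathbb{C}x$ and
$B\oplus\mathbb{C}y$ is $\arccos|\langle x,y\rangle|$. The images under $\phi$ have the same shape,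
so $x\mapsto t$ preserves $|\langle x,y\rangle|$ (`norm_inner_eq_of_increment`). Wigner's theorem
for maps not assumed surjective (`wigner`) yields a linear or conjugate-linear isometry $U$ with
$U(\operatorname{Im}P)\subseteq\operatorname{Im}\phi(P)$. Applied to $P$ and its complement, this
gives $\phi(P)U=UP$. The range of $U$ is therefore invariant under all of $P_\infty(H)$, hence is
$H$. -/

theorem Submodule.not_finiteDimensional_of_forall_finset {K : Submodule ℂ H}
    (h : ∀ s : Finset H, ∃ u ∈ K, ‖u‖ = 1 ∧ ∀ w ∈ s, ⟪w, u⟫_ℂ = 0) :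
    ¬ FiniteDimensional ℂ K := by
  intro hK
  obtain ⟨s, hs⟩ := (Submodule.fg_iff_finiteDimensional K).2 hK
  obtain ⟨u, hu, hu1, hsu⟩ := h s
  have : u ∈ (Submodule.span ℂ (s : Set H))ᗮ := by
    rw [Submodule.mem_orthogonal]
    intro w hw
    induction hw using Submodule.span_induction with
    | mem x hx => exact hsu x hx
    | zero => simp
    | add x y _ _ hx hy => rw [inner_add_left, hx, hy, add_zero]
    | smul a x _ hx => rw [inner_smul_left, hx, mul_zero]
  rw [hs] at this
  have h0 := Submodule.inner_right_of_mem_orthogonal hu this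
  rw [inner_self_eq_zero] at h0
  simp [h0] at hu1

theorem Submodule.exists_unit_orthogonal_finset {K : Submodule ℂ H}
    (hK : ¬ FiniteDimensional ℂ K) (s : Finset H) :
    ∃ u ∈ K, ‖u‖ = 1 ∧ ∀ w ∈ s, ⟪w, u⟫_ℂ = 0 := by
  classical
  let f : K →ₗ[ℂ] (s → ℂ) :=
    LinearMap.pi fun w => (innerSL ℂ (w : H)).toLinearMap ∘ₗ K.subtype
  have hf : ¬ Function.Injective f := fun hi => hK (FiniteDimensional.of_injective f hi)
  rw [← LinearMap.ker_eq_bot, Submodule.eq_bot_iff] at hf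
  push Not at hf
  obtain ⟨v, hv, hv0⟩ := hf
  have hv0' : (v : H) ≠ 0 := by simpa using hv0
  refine ⟨((‖(v : H)‖ : ℂ)⁻¹) • (v : H), K.smul_mem _ v.2, norm_smul_inv_norm hv0', ?_⟩
  intro w hw
  have := congrFun (LinearMap.mem_ker.1 hv) ⟨w, hw⟩
  have h2 : ⟪w, (v : H)⟫_ℂ = 0 := by simpa [f] using this
  rw [inner_smul_right, h2, mul_zero]

theorem Submodule.not_finiteDimensional_inf_span_orthogonal {K : Submodule ℂ H}
    (hK : ¬ FiniteDimensional ℂ K) (x : H) :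
    ¬ FiniteDimensional ℂ (K ⊓ (ℂ ∙ x)ᗮ : Submodule ℂ H) := by
  classical
  refine Submodule.not_finiteDimensional_of_forall_finset fun s => ?_
  obtain ⟨u, hu, hu1, hs⟩ := Submodule.exists_unit_orthogonal_finset hK (insert x s)
  exact ⟨u, ⟨hu, Submodule.mem_orthogonal_singleton_iff_inner_right.2 (hs x (by simp))⟩, hu1,
    fun w hw => hs w (by simp [hw])⟩

theorem Submodule.not_finiteDimensional_mono {K L : Submodule ℂ H} (h : K ≤ L)
    (hK : ¬ FiniteDimensional ℂ K) : ¬ FiniteDimensional ℂ L :=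
  fun _ => hK (Submodule.finiteDimensional_of_le h)

theorem Submodule.not_finiteDimensional_of_orthonormal {K : Submodule ℂ H} {v : ℕ → H}
    (hv : Orthonormal ℂ v) (hK : ∀ n, v n ∈ K) : ¬ FiniteDimensional ℂ K := by
  intro h
  have hli : LinearIndependent ℂ (fun n => (⟨v n, hK n⟩ : K)) :=
    LinearIndependent.of_comp K.subtype hv.linearIndependent
  exact (not_finite_iff_infinite.2 (inferInstance : Infinite ℕ)) hli.finite

/-- Biorthogonal unit sequences in two infinite-dimensional subspaces. -/
theorem Submodule.exists_seq_pair {K L : Submodule ℂ H} (hK : ¬ FiniteDimensional ℂ K)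
    (hL : ¬ FiniteDimensional ℂ L) :
    ∃ f : ℕ → H × H, (∀ n, (f n).1 ∈ K ∧ (f n).2 ∈ L ∧ ‖(f n).1‖ = 1 ∧ ‖(f n).2‖ = 1) ∧
      Pairwise fun m n => ⟪(f m).1, (f n).1⟫_ℂ = 0 ∧ ⟪(f m).1, (f n).2⟫_ℂ = 0 ∧
        ⟪(f m).2, (f n).1⟫_ℂ = 0 ∧ ⟪(f m).2, (f n).2⟫_ℂ = 0 := by
  classical
  -- Only pairs with different indices are constrained; the two vectors sharing an index may have
  -- any inner product.
  let r : H × H → H × H → Prop := fun p q => ⟪p.1, q.1⟫_ℂ = 0 ∧ ⟪p.1, q.2⟫_ℂ = 0 ∧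
    ⟪p.2, q.1⟫_ℂ = 0 ∧ ⟪p.2, q.2⟫_ℂ = 0
  have : Std.Symm r := ⟨fun p q h => ⟨inner_eq_zero_symm.1 h.1, inner_eq_zero_symm.1 h.2.2.1,
    inner_eq_zero_symm.1 h.2.1, inner_eq_zero_symm.1 h.2.2.2⟩⟩
  refine exists_seq_of_forall_finset_exists'
    (fun p : H × H => p.1 ∈ K ∧ p.2 ∈ L ∧ ‖p.1‖ = 1 ∧ ‖p.2‖ = 1) r fun s _ => ?_
  obtain ⟨u, hu, hu1, hus⟩ := Submodule.exists_unit_orthogonal_finset hK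
    (s.image Prod.fst ∪ s.image Prod.snd)
  obtain ⟨v, hv, hv1, hvs⟩ := Submodule.exists_unit_orthogonal_finset hL
    (s.image Prod.fst ∪ s.image Prod.snd)
  refine ⟨(u, v), ⟨hu, hv, hu1, hv1⟩, fun p hp => ?_⟩
  have h1 : p.1 ∈ s.image Prod.fst ∪ s.image Prod.snd :=
    Finset.mem_union_left _ (Finset.mem_image_of_mem _ hp)
  have h2 : p.2 ∈ s.image Prod.fst ∪ s.image Prod.snd :=
    Finset.mem_union_right _ (Finset.mem_image_of_mem _ hp)
  exact ⟨hus _ h1, hvs _ h1, hus _ h2, hvs _ h2⟩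

/-! ### Members of $P_\infty(H)$ as closed subspaces: adjoining vectors, closed spans, chains. -/

variable [CompleteSpace H]

/-- The image of a projection, as a subspace. -/
def ProjInf.im (P : ProjInf H) : Submodule ℂ H := (P : H →L[ℂ] H).range

namespace ProjInf

instance (P : ProjInf H) : (im P).HasOrthogonalProjection :=
  (isStarProjection_iff_eq_starProjection_range.1 P.2.1).1

theorem coe_eq_starProjection (P : ProjInf H) : (P : H →L[ℂ] H) = (im P).starProjection :=
  (isStarProjection_iff_eq_starProjection_range.1 P.2.1).2

theorem not_finiteDimensional_im (P : ProjInf H) : ¬ FiniteDimensional ℂ (im P) := P.2.2.1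

theorem not_finiteDimensional_im_orthogonal (P : ProjInf H) :
    ¬ FiniteDimensional ℂ (im P)ᗮ := by
  have := P.2.2.2
  rwa [coe_eq_starProjection, Submodule.ker_starProjection] at this

theorem exists_im_eq {K : Submodule ℂ H} (hc : IsClosed (K : Set H))
    (hK : ¬ FiniteDimensional ℂ K) (hK' : ¬ FiniteDimensional ℂ Kᗮ) :
    ∃ P : ProjInf H, im P = K := by
  have : CompleteSpace K := hc.completeSpace_coe
  refine ⟨⟨K.starProjection, isStarProjection_starProjection, ?_, ?_⟩, ?_⟩
  · rwa [Submodule.range_starProjection]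
  · rwa [Submodule.ker_starProjection]
  · simp [im]

/-- The orthogonal complement in `P_∞(H)`. -/
theorem exists_im_eq_orthogonal (P : ProjInf H) : ∃ Q : ProjInf H, im Q = (im P)ᗮ :=
  exists_im_eq (Submodule.isClosed_orthogonal _) (not_finiteDimensional_im_orthogonal P) (by
    rw [Submodule.orthogonal_orthogonal]; exact (not_finiteDimensional_im P))

/-- `M` is `A` with the vector `x` adjoined. -/
structure IsAdjoin (A : ProjInf H) (x : H) (M : ProjInf H) : Prop where
  orthogonal : x ∈ (im A)ᗮ
  le : im A ≤ im M
  mem : x ∈ im M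
  sub_mem : ∀ u ∈ im M, u - ⟪x, u⟫_ℂ • x ∈ im A

theorem exists_isAdjoin {A : ProjInf H} {x : H} (hx : ‖x‖ = 1) (hxA : x ∈ (im A)ᗮ) :
    ∃ M, IsAdjoin A x M := by
  have key : im A ≤ ((im A)ᗮ ⊓ (ℂ ∙ x)ᗮ)ᗮ :=
    (Submodule.le_orthogonal_orthogonal _).trans (Submodule.orthogonal_le inf_le_left)
  have key2 : ((im A)ᗮ ⊓ (ℂ ∙ x)ᗮ)ᗮᗮ = (im A)ᗮ ⊓ (ℂ ∙ x)ᗮ := by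
    rw [Submodule.inf_orthogonal, Submodule.triorthogonal_eq_orthogonal]
  -- Writing $A\oplus\mathbb{C}x$ as an orthogonal complement makes closedness automatic.
  obtain ⟨M, hM⟩ := exists_im_eq (K := ((im A)ᗮ ⊓ (ℂ ∙ x)ᗮ)ᗮ) (Submodule.isClosed_orthogonal _)
    (Submodule.not_finiteDimensional_mono key (not_finiteDimensional_im A)) (by
      rw [key2]
      exact Submodule.not_finiteDimensional_inf_span_orthogonal
        (not_finiteDimensional_im_orthogonal A) x)
  refine ⟨M, hxA, hM ▸ key, ?_, ?_⟩
  · rw [hM]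
    exact Submodule.orthogonal_le inf_le_right
      (Submodule.le_orthogonal_orthogonal _ (Submodule.mem_span_singleton_self x))
  · intro u hu
    rw [← Submodule.orthogonal_orthogonal (im A), Submodule.mem_orthogonal]
    intro w hw
    have hxx : ⟪x, x⟫_ℂ = 1 := by simp [inner_self_eq_norm_sq_to_K, hx]
    have hw' : w - ⟪x, w⟫_ℂ • x ∈ (im A)ᗮ ⊓ (ℂ ∙ x)ᗮ := by
      refine ⟨Submodule.sub_mem _ hw (Submodule.smul_mem _ _ hxA), ?_⟩
      rw [SetLike.mem_coe, Submodule.mem_orthogonal_singleton_iff_inner_right, inner_sub_right,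
        inner_smul_right, hxx]
      ring
    rw [hM] at hu
    have := Submodule.inner_right_of_mem_orthogonal hw' hu
    rw [inner_sub_left, inner_smul_left, inner_conj_symm] at this
    rw [inner_sub_right, inner_smul_right]
    linear_combination this

/-- The closed span of an orthonormal sequence whose complement contains another such sequence. -/
theorem exists_closedSpan {v w : ℕ → H} (hv : Orthonormal ℂ v) (hw : Orthonormal ℂ w)
    (hvw : ∀ m n, ⟪v m, w n⟫_ℂ = 0) :
    ∃ P : ProjInf H, (∀ n, v n ∈ im P) ∧ ∀ u, u ∈ (im P)ᗮ ↔ ∀ n, ⟪v n, u⟫_ℂ = 0 := by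
  have hmem : ∀ n, v n ∈ (Submodule.span ℂ (Set.range v))ᗮᗮ := fun n =>
    Submodule.le_orthogonal_orthogonal _ (Submodule.subset_span ⟨n, rfl⟩)
  have hiff : ∀ u, u ∈ (Submodule.span ℂ (Set.range v))ᗮ ↔ ∀ n, ⟪v n, u⟫_ℂ = 0 := by
    intro u
    rw [← Submodule.mem_toAddSubmonoid, Submodule.mem_toAddSubmonoid,
      ← Submodule.span_singleton_le_iff_mem, ← Submodule.isOrtho_iff_le, Submodule.isOrtho_span]
    simp only [Set.mem_singleton_iff, forall_eq, Set.forall_mem_range]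
    exact forall_congr' fun n => inner_eq_zero_symm
  obtain ⟨P, hP⟩ := exists_im_eq (K := (Submodule.span ℂ (Set.range v))ᗮᗮ)
    (Submodule.isClosed_orthogonal _) (Submodule.not_finiteDimensional_of_orthonormal hv hmem) (by
      rw [Submodule.triorthogonal_eq_orthogonal]
      exact Submodule.not_finiteDimensional_of_orthonormal hw
        fun n => (hiff _).2 fun m => hvw m n)
  refine ⟨P, fun n => hP ▸ hmem n, fun u => ?_⟩
  rw [hP, Submodule.triorthogonal_eq_orthogonal, hiff]

theorem im_le_of_forall_mem {P Q : ProjInf H} {v : ℕ → H}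
    (hP : ∀ u, u ∈ (im P)ᗮ ↔ ∀ n, ⟪v n, u⟫_ℂ = 0) (hQ : ∀ n, v n ∈ im Q) : im P ≤ im Q := by
  rw [← Submodule.orthogonal_le_orthogonal_iff]
  exact fun u hu => (hP u).2 fun n => Submodule.inner_right_of_mem_orthogonal (hQ n) hu

/-- Two orthogonal projections of infinite rank whose images are orthogonal to two vectors. -/
theorem exists_orthogonal_pair (hH : ¬ FiniteDimensional ℂ H) (x y : H) :
    ∃ A B : ProjInf H, im A ⟂ im B ∧ x ∈ (im A)ᗮ ∧ y ∈ (im A)ᗮ ∧ x ∈ (im B)ᗮ ∧ y ∈ (im B)ᗮ := by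
  have hK : ¬ FiniteDimensional ℂ ((⊤ ⊓ (ℂ ∙ x)ᗮ) ⊓ (ℂ ∙ y)ᗮ : Submodule ℂ H) := by
    refine Submodule.not_finiteDimensional_inf_span_orthogonal
      (Submodule.not_finiteDimensional_inf_span_orthogonal (fun h => hH ?_) x) y
    exact Module.Finite.equiv (Submodule.topEquiv (R := ℂ) (M := H))
  obtain ⟨f, hf, hfo⟩ := Submodule.exists_seq_pair hK hK
  have ho : ∀ k : ℕ → ℕ, Function.Injective k → Orthonormal ℂ fun n => (f (k n)).1 :=
    fun k hk => ⟨fun n => (hf _).2.2.1, fun m n h => (hfo (hk.ne h)).1⟩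
  -- Residue 0 mod 3 spans $A$, residue 1 spans $B$, and residue 2 is left to make the complement of
  -- $B$ infinite-dimensional.
  have ho' : ∀ i j : ℕ, i < 3 → j < 3 → i ≠ j → ∀ m n : ℕ,
      ⟪(f (3 * m + i)).1, (f (3 * n + j)).1⟫_ℂ = 0 :=
    fun i j hi hj hij m n => (hfo (by omega)).1
  obtain ⟨A, hA, hA'⟩ := exists_closedSpan (ho (fun n => 3 * n + 0) fun m n h => by simpa using h)
    (ho (fun n => 3 * n + 1) fun m n h => by simpa using h) (ho' 0 1 (by simp) (by simp) (by simp))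
  obtain ⟨B, hB, hB'⟩ := exists_closedSpan (ho (fun n => 3 * n + 1) fun m n h => by simpa using h)
    (ho (fun n => 3 * n + 2) fun m n h => by simpa using h) (ho' 1 2 (by simp) (by simp) (by simp))
  have hxf : ∀ n, ⟪(f n).1, x⟫_ℂ = 0 := fun n =>
    Submodule.mem_orthogonal_singleton_iff_inner_left.1 (hf n).1.1.2
  have hyf : ∀ n, ⟪(f n).1, y⟫_ℂ = 0 := fun n =>
    Submodule.mem_orthogonal_singleton_iff_inner_left.1 (hf n).1.2
  refine ⟨A, B, ?_, (hA' _).2 fun n => hxf _, (hA' _).2 fun n => hyf _, (hB' _).2 fun n => hxf _,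
    (hB' _).2 fun n => hyf _⟩
  rw [Submodule.isOrtho_comm, Submodule.isOrtho_iff_le]
  intro u hu
  rw [hA']
  intro n
  refine Submodule.inner_left_of_mem_orthogonal hu ((hB' _).2 fun m => ?_)
  exact ho' 1 0 (by simp) (by simp) (by simp) m n

/-- Any two members of `P_∞(H)` orthogonal to `x` are linked by a chain of inclusions of infinite
relative codimension, through members orthogonal to `x`. -/
theorem exists_chain (A B : ProjInf H) {x : H} (hA : x ∈ (im A)ᗮ) (hB : x ∈ (im B)ᗮ) :
    ∃ A₀ B₀ C : ProjInf H, x ∈ (im C)ᗮ ∧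
      (im A₀ ≤ im A ∧ ¬ FiniteDimensional ℂ (im A ⊓ (im A₀)ᗮ : Submodule ℂ H)) ∧
      (im A₀ ≤ im C ∧ ¬ FiniteDimensional ℂ (im C ⊓ (im A₀)ᗮ : Submodule ℂ H)) ∧
      (im B₀ ≤ im C ∧ ¬ FiniteDimensional ℂ (im C ⊓ (im B₀)ᗮ : Submodule ℂ H)) ∧
      (im B₀ ≤ im B ∧ ¬ FiniteDimensional ℂ (im B ⊓ (im B₀)ᗮ : Submodule ℂ H)) := by
  obtain ⟨f, hf, hfo⟩ := Submodule.exists_seq_pair (not_finiteDimensional_im A) (not_finiteDimensional_im B)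
  have hoa : ∀ k : ℕ → ℕ, Function.Injective k → Orthonormal ℂ fun n => (f (k n)).1 :=
    fun k hk => ⟨fun n => (hf _).2.2.1, fun m n h => (hfo (hk.ne h)).1⟩
  have hob : ∀ k : ℕ → ℕ, Function.Injective k → Orthonormal ℂ fun n => (f (k n)).2 :=
    fun k hk => ⟨fun n => (hf _).2.2.2, fun m n h => (hfo (hk.ne h)).2.2.2⟩
  have hinj : ∀ i : ℕ, Function.Injective fun n => 3 * n + i := fun i m n h => by simpa using h
  -- `c` interleaves the vectors of $A$ with index $3n$, which span $A_0$, and those of $B$ with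
  -- index $3n+1$, which span $B_0$. No index is used from both sides, so `c` is orthonormal; the
  -- indices $3n+2$ witness the remaining infinite codimensions.
  let c : ℕ → H := fun n => if n % 2 = 0 then (f (3 * (n / 2))).1 else (f (3 * (n / 2) + 1)).2
  have hc0 : ∀ n, c (2 * n) = (f (3 * n)).1 := fun n => by simp [c]
  have hc1 : ∀ n, c (2 * n + 1) = (f (3 * n + 1)).2 := fun n => by
    have : (2 * n + 1) / 2 = n := by omega
    simp [c, this, Nat.add_mod]
  have hcon : Orthonormal ℂ c := by
    refine ⟨fun n => ?_, fun m n h => ?_⟩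
    · dsimp only [c]
      split_ifs
      · exact (hf _).2.2.1
      · exact (hf _).2.2.2
    · dsimp only [c]
      split_ifs
      · exact (hfo (by omega)).1
      · exact (hfo (by omega)).2.1
      · exact (hfo (by omega)).2.2.1
      · exact (hfo (by omega)).2.2.2
  obtain ⟨A₀, hA₀, hA₀'⟩ := exists_closedSpan (hoa _ (hinj 0)) (hob _ (hinj 1))
    fun m n => (hfo (by omega)).2.1
  obtain ⟨B₀, hB₀, hB₀'⟩ := exists_closedSpan (hob _ (hinj 1)) (hoa _ (hinj 0))
    fun m n => (hfo (by omega)).2.2.1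
  obtain ⟨C, hC, hC'⟩ := exists_closedSpan hcon (hoa _ (hinj 2)) fun m n => by
    dsimp only [c]
    split_ifs
    · exact (hfo (by omega)).1
    · exact (hfo (by omega)).2.2.1
  refine ⟨A₀, B₀, C, (hC' x).2 fun n => ?_, ⟨im_le_of_forall_mem hA₀' fun n => (hf _).1, ?_⟩,
    ⟨im_le_of_forall_mem hA₀' fun n => hc0 n ▸ hC _, ?_⟩,
    ⟨im_le_of_forall_mem hB₀' fun n => hc1 n ▸ hC _, ?_⟩,
    ⟨im_le_of_forall_mem hB₀' fun n => (hf _).2.1, ?_⟩⟩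
  · dsimp only [c]
    split_ifs
    · exact Submodule.inner_right_of_mem_orthogonal (hf _).1 hA
    · exact Submodule.inner_right_of_mem_orthogonal (hf _).2.1 hB
  · exact Submodule.not_finiteDimensional_of_orthonormal (hoa _ (hinj 2))
      fun n => ⟨(hf _).1, (hA₀' _).2 fun m => (hfo (by omega)).1⟩
  · exact Submodule.not_finiteDimensional_of_orthonormal (hob _ (hinj 1))
      fun n => ⟨hc1 n ▸ hC _, (hA₀' _).2 fun m => (hfo (by omega)).2.1⟩
  · exact Submodule.not_finiteDimensional_of_orthonormal (hoa _ (hinj 0))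
      fun n => ⟨hc0 n ▸ hC _, (hB₀' _).2 fun m => (hfo (by omega)).2.2.1⟩
  · exact Submodule.not_finiteDimensional_of_orthonormal (hob _ (hinj 2))
      fun n => ⟨(hf _).2.1, (hB₀' _).2 fun m => (hfo (by omega)).2.2.2⟩

end ProjInf

end Grassmannian

/-! ### Angles, the order on images, and the induced map on vectors. -/

section AnglePreserving

variable {H : Type*} [NormedAddCommGroup H] [InnerProductSpace ℂ H] [CompleteSpace H]

namespace ProjInf

theorem exists_unit_mem_im (P : ProjInf H) : ∃ x ∈ im P, ‖x‖ = 1 := by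
  obtain ⟨x, hx, hx1, -⟩ := Submodule.exists_unit_orthogonal_finset (not_finiteDimensional_im P) ∅
  exact ⟨x, hx, hx1⟩

theorem infAngle_eq_pi_div_two_iff (P Q : ProjInf H) :
    infAngle (P : H →L[ℂ] H) (Q : H →L[ℂ] H) = Real.pi / 2 ↔ im P ⟂ im Q := by
  obtain ⟨x₀, hx₀, hx₀1⟩ := exists_unit_mem_im P
  obtain ⟨y₀, hy₀, hy₀1⟩ := exists_unit_mem_im Q
  rw [Submodule.isOrtho_iff_inner_eq]
  constructor
  · intro h
    have key : ∀ x ∈ im P, ∀ y ∈ im Q, ‖x‖ = 1 → ‖y‖ = 1 → ⟪x, y⟫_ℂ = 0 := by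
      intro x hx y hy hx1 hy1
      have h1 : infAngle (P : H →L[ℂ] H) (Q : H →L[ℂ] H) ≤ unitAngle x y :=
        csInf_le (imageAngles_bddBelow _ _) ⟨x, hx, y, hy, hx1, hy1, rfl⟩
      rw [h, unitAngle, Real.arccos, le_sub_self_iff, Real.arcsin_nonpos] at h1
      exact norm_le_zero_iff.1 h1
    intro x hx y hy
    rcases eq_or_ne x 0 with rfl | hx0
    · simp
    rcases eq_or_ne y 0 with rfl | hy0
    · simp
    have := key _ ((im P).smul_mem ((‖x‖ : ℂ)⁻¹) hx) _ ((im Q).smul_mem ((‖y‖ : ℂ)⁻¹) hy)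
      (norm_smul_inv_norm hx0) (norm_smul_inv_norm hy0)
    simpa [inner_smul_left, inner_smul_right, hx0, hy0] using this
  · intro h
    have : imageAngles (P : H →L[ℂ] H) (Q : H →L[ℂ] H) = {Real.pi / 2} := by
      refine Set.eq_singleton_iff_unique_mem.2 ⟨⟨x₀, hx₀, y₀, hy₀, hx₀1, hy₀1, ?_⟩, ?_⟩
      · simp [unitAngle, h x₀ hx₀ y₀ hy₀]
      · rintro t ⟨x, hx, y, hy, -, -, rfl⟩
        simp [unitAngle, h x hx y hy]
    rw [infAngle, this, csInf_singleton]

/-- When the pairing of the two images factors through the single pair $x,y$, Cauchy–Schwarz bounds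
the outer factors by 1, so that pair attains the infimum. -/
theorem infAngle_eq_arccos {P Q : ProjInf H} {x y : H} (hx : x ∈ im P) (hy : y ∈ im Q)
    (hx1 : ‖x‖ = 1) (hy1 : ‖y‖ = 1)
    (h : ∀ u ∈ im P, ∀ v ∈ im Q, ⟪u, v⟫_ℂ = ⟪u, x⟫_ℂ * ⟪x, y⟫_ℂ * ⟪y, v⟫_ℂ) :
    infAngle (P : H →L[ℂ] H) (Q : H →L[ℂ] H) = Real.arccos ‖⟪x, y⟫_ℂ‖ := by
  refine IsLeast.csInf_eq ⟨⟨x, hx, y, hy, hx1, hy1, rfl⟩, ?_⟩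
  rintro t ⟨u, hu, v, hv, hu1, hv1, rfl⟩
  refine Real.antitone_arccos ?_
  rw [h u hu v hv, norm_mul, norm_mul]
  have h1 : ‖⟪u, x⟫_ℂ‖ ≤ 1 := by simpa [hu1, hx1] using norm_inner_le_norm (𝕜 := ℂ) u x
  have h2 : ‖⟪y, v⟫_ℂ‖ ≤ 1 := by simpa [hv1, hy1] using norm_inner_le_norm (𝕜 := ℂ) y v
  calc ‖⟪u, x⟫_ℂ‖ * ‖⟪x, y⟫_ℂ‖ * ‖⟪y, v⟫_ℂ‖ ≤ 1 * ‖⟪x, y⟫_ℂ‖ * 1 := by gcongr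
    _ = _ := by ring

/-- The inner product between vectors of two images which are orthogonal up to one line each. -/
theorem inner_eq_of_orthogonal_remainders {A B : ProjInf H} {x y u v : H}
    (hAB : im A ⟂ im B) (hyA : y ∈ (im A)ᗮ) (hxB : x ∈ (im B)ᗮ)
    (hu : u - ⟪x, u⟫_ℂ • x ∈ im A) (hv : v - ⟪y, v⟫_ℂ • y ∈ im B) :
    ⟪u, v⟫_ℂ = ⟪u, x⟫_ℂ * ⟪x, y⟫_ℂ * ⟪y, v⟫_ℂ := by
  have h1 := hAB.inner_eq hu hv
  have h2 := Submodule.inner_right_of_mem_orthogonal hu hyA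
  have h3 := Submodule.inner_left_of_mem_orthogonal hv hxB
  simp only [inner_sub_left, inner_sub_right, inner_smul_left, inner_smul_right,
    inner_conj_symm] at h1 h2 h3
  linear_combination h1 + ⟪y, v⟫_ℂ * h2 + ⟪u, x⟫_ℂ * h3

variable {φ : ProjInf H → ProjInf H}

/-- Inclusion is expressible by orthogonality: $P\le Q$ means that whatever is orthogonal to $Q$ is
orthogonal to $P$; the complement of $Q$ is the decisive test. -/
theorem im_le_iff (hφ : Function.Surjective φ)
    (ho : ∀ P Q, im P ⟂ im Q ↔ im (φ P) ⟂ im (φ Q)) (P Q : ProjInf H) :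
    im (φ P) ≤ im (φ Q) ↔ im P ≤ im Q := by
  have key : ∀ P Q : ProjInf H, im P ≤ im Q ↔ ∀ R, im R ⟂ im Q → im R ⟂ im P := by
    refine fun P Q => ⟨fun h R hR => hR.mono_right h, fun h => ?_⟩
    obtain ⟨R, hR⟩ := exists_im_eq_orthogonal Q
    have := (h R (hR ▸ Submodule.isOrtho_orthogonal_left _)).ge
    rwa [hR, Submodule.orthogonal_orthogonal] at this
  rw [key, key, hφ.forall]
  simp only [← ho]

theorem im_compl (hφ : Function.Surjective φ)
    (ho : ∀ P Q, im P ⟂ im Q ↔ im (φ P) ⟂ im (φ Q)) {P P' : ProjInf H} (h : im P' = (im P)ᗮ) :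
    im (φ P') = (im (φ P))ᗮ := by
  refine le_antisymm ((ho _ _).1 (h ▸ Submodule.isOrtho_orthogonal_left _)).le ?_
  obtain ⟨Q, hQ⟩ := exists_im_eq_orthogonal (φ P)
  obtain ⟨R, rfl⟩ := hφ Q
  rw [← hQ, im_le_iff hφ ho, h]
  exact ((ho R P).2 (hQ ▸ Submodule.isOrtho_orthogonal_left _)).le

/-- The one-dimensional space by which `φ` enlarges when a vector is adjoined. -/
theorem exists_span_eq_increment (hφ : Function.Surjective φ)
    (ho : ∀ P Q, im P ⟂ im Q ↔ im (φ P) ⟂ im (φ Q)) {A M : ProjInf H} {x : H} (hx : ‖x‖ = 1)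
    (hAM : IsAdjoin A x M) :
    ∃ t : H, ‖t‖ = 1 ∧ im (φ M) ⊓ (im (φ A))ᗮ = ℂ ∙ t := by
  have hle := (im_le_iff hφ ho A M).2 hAM.le
  have hne : im (φ M) ⊓ (im (φ A))ᗮ ≠ ⊥ := by
    intro h
    have h1 : im (φ M) ≤ im (φ A) := by
      intro u hu
      have : u - (im (φ A)).starProjection u ∈ im (φ M) ⊓ (im (φ A))ᗮ :=
        ⟨Submodule.sub_mem _ hu (hle (Submodule.starProjection_apply_mem _ _)),
          Submodule.sub_starProjection_mem_orthogonal _⟩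
      rw [h, Submodule.mem_bot, sub_eq_zero] at this
      rw [this]
      exact Submodule.starProjection_apply_mem _ _
    have h2 := (im_le_iff hφ ho M A).1 h1 hAM.mem
    have h3 := Submodule.inner_right_of_mem_orthogonal h2 hAM.orthogonal
    rw [inner_self_eq_zero] at h3
    simp [h3] at hx
  obtain ⟨t₀, ht₀, ht₀0⟩ := (Submodule.ne_bot_iff _).1 hne
  have ht : ((‖t₀‖ : ℂ)⁻¹) • t₀ ∈ im (φ M) ⊓ (im (φ A))ᗮ := Submodule.smul_mem _ _ ht₀
  have ht1 : ‖((‖t₀‖ : ℂ)⁻¹) • t₀‖ = 1 := norm_smul_inv_norm ht₀0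
  generalize ((‖t₀‖ : ℂ)⁻¹) • t₀ = t at ht ht1
  refine ⟨t, ht1, le_antisymm ?_ ((Submodule.span_singleton_le_iff_mem _ _).2 ht)⟩
  -- The preimage $R$ of $\phi(A)\oplus\mathbb{C}t$ lies between $A$ and $M$ and is not $A$, hence
  -- is $M$. So $\phi(M)$ exceeds $\phi(A)$ by the line of $t$ alone.
  obtain ⟨N, -, hAN, htN, hN⟩ := exists_isAdjoin ht1 ht.2
  obtain ⟨R, rfl⟩ := hφ N
  have hAR := (im_le_iff hφ ho A R).1 hAN
  have hNM : im (φ R) ≤ im (φ M) := by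
    intro u hu
    rw [← sub_add_cancel u (⟪t, u⟫_ℂ • t)]
    exact Submodule.add_mem _ (hle (hN u hu)) (Submodule.smul_mem _ _ ht.1)
  have hRM := (im_le_iff hφ ho R M).1 hNM
  have hMR : im M ≤ im R := by
    have hxR : x ∈ im R := by
      by_contra hxR
      have : im R ≤ im A := by
        intro u hu
        have h1 := hAM.sub_mem u (hRM hu)
        by_cases h0 : ⟪x, u⟫_ℂ = 0
        · simpa [h0] using h1
        · refine absurd ?_ hxR
          have h2 : ⟪x, u⟫_ℂ • x ∈ im R := by
            have := Submodule.sub_mem _ hu (hAR h1)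
            rwa [sub_sub_cancel] at this
          exact (Submodule.smul_mem_iff _ h0).1 h2
      have htA := (im_le_iff hφ ho R A).2 this htN
      have h3 := Submodule.inner_right_of_mem_orthogonal htA ht.2
      rw [inner_self_eq_zero] at h3
      simp [h3] at ht1
    intro u hu
    rw [← sub_add_cancel u (⟪x, u⟫_ℂ • x)]
    exact Submodule.add_mem _ (hAR (hAM.sub_mem u hu)) (Submodule.smul_mem _ _ hxR)
  intro u hu
  have h1 := hN u ((im_le_iff hφ ho M R).2 hMR hu.1)
  have h2 : u - ⟪t, u⟫_ℂ • t ∈ (im (φ A))ᗮ :=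
    Submodule.sub_mem _ hu.2 (Submodule.smul_mem _ _ ht.2)
  have h3 := Submodule.inner_right_of_mem_orthogonal h1 h2
  rw [inner_self_eq_zero, sub_eq_zero] at h3
  rw [h3]
  exact Submodule.smul_mem _ _ (Submodule.mem_span_singleton_self t)

/-- The closed span of $\phi(A)$ and $\phi(D)$ lies inside $\phi(B)$, so it belongs to $P_\infty(H)$
and equals some $\phi(R)$. Then $R$ contains $A$ and $D$, hence $B$, and the closed span is all of
$\phi(B)$. -/
theorem mem_orthogonal_of_sup (hφ : Function.Surjective φ)
    (ho : ∀ P Q, im P ⟂ im Q ↔ im (φ P) ⟂ im (φ Q)) {A D B : ProjInf H} (hAB : im A ≤ im B)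
    (hDB : im D = im B ⊓ (im A)ᗮ) {u : H} (huA : u ∈ (im (φ A))ᗮ) (huD : u ∈ (im (φ D))ᗮ) :
    u ∈ (im (φ B))ᗮ := by
  have hDB' : im D ≤ im B := hDB ▸ inf_le_left
  have hS : (im (φ A) ⊔ im (φ D))ᗮᗮ ≤ im (φ B) := by
    rw [← Submodule.orthogonal_orthogonal (im (φ B))]
    exact Submodule.orthogonal_orthogonal_monotone
      (sup_le ((im_le_iff hφ ho _ _).2 hAB) ((im_le_iff hφ ho _ _).2 hDB'))
  obtain ⟨S, hS'⟩ := exists_im_eq (K := (im (φ A) ⊔ im (φ D))ᗮᗮ) (Submodule.isClosed_orthogonal _)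
    (Submodule.not_finiteDimensional_mono
      (le_sup_left.trans (Submodule.le_orthogonal_orthogonal _)) (not_finiteDimensional_im (φ A)))
    (Submodule.not_finiteDimensional_mono (Submodule.orthogonal_le hS)
      (not_finiteDimensional_im_orthogonal (φ B)))
  obtain ⟨R, rfl⟩ := hφ S
  have hAR : im A ≤ im R := by
    rw [← im_le_iff hφ ho, hS']
    exact le_sup_left.trans (Submodule.le_orthogonal_orthogonal _)
  have hDR : im D ≤ im R := by
    rw [← im_le_iff hφ ho, hS']
    exact le_sup_right.trans (Submodule.le_orthogonal_orthogonal _)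
  have hBR : im B ≤ im R := by
    intro v hv
    rw [← sub_add_cancel v ((im A).starProjection v)]
    refine Submodule.add_mem _ (hDR ?_) (hAR (Submodule.starProjection_apply_mem _ _))
    rw [hDB]
    exact ⟨Submodule.sub_mem _ hv (hAB (Submodule.starProjection_apply_mem _ _)),
      Submodule.sub_starProjection_mem_orthogonal _⟩
  have h1 : u ∈ (im (φ R))ᗮ := by
    rw [hS', Submodule.triorthogonal_eq_orthogonal, ← Submodule.inf_orthogonal]
    exact ⟨huA, huD⟩
  exact Submodule.orthogonal_le ((im_le_iff hφ ho B R).2 hBR) h1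

/-- Infinite codimension puts $D=B\ominus A$ in $P_\infty(H)$. Since $D\perp M$, the increment at
$A$ is orthogonal to both $\phi(A)$ and $\phi(D)$, hence to $\phi(B)$; one line inside another is
equal to it. -/
theorem increment_eq_of_le (hφ : Function.Surjective φ)
    (ho : ∀ P Q, im P ⟂ im Q ↔ im (φ P) ⟂ im (φ Q)) {A M B N : ProjInf H} {x : H} (hx : ‖x‖ = 1)
    (hM : IsAdjoin A x M) (hN : IsAdjoin B x N)
    (hAB : im A ≤ im B ∧ ¬ FiniteDimensional ℂ (im B ⊓ (im A)ᗮ : Submodule ℂ H)) :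
    im (φ M) ⊓ (im (φ A))ᗮ = im (φ N) ⊓ (im (φ B))ᗮ := by
  obtain ⟨t, ht, hMt⟩ := exists_span_eq_increment hφ ho hx hM
  obtain ⟨s, hs, hNs⟩ := exists_span_eq_increment hφ ho hx hN
  have hle : im (φ M) ⊓ (im (φ A))ᗮ ≤ im (φ N) ⊓ (im (φ B))ᗮ := by
    obtain ⟨D, hD⟩ := exists_im_eq (K := im B ⊓ (im A)ᗮ)
      ((im B).orthogonal_orthogonal ▸ (Submodule.isClosed_orthogonal _).inter
        (Submodule.isClosed_orthogonal _)) hAB.2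
      (Submodule.not_finiteDimensional_mono (Submodule.orthogonal_le inf_le_left)
        (not_finiteDimensional_im_orthogonal B))
    have hMN : im M ≤ im N := by
      intro u hu
      rw [← sub_add_cancel u (⟪x, u⟫_ℂ • x)]
      exact Submodule.add_mem _ (hN.le (hAB.1 (hM.sub_mem u hu))) (Submodule.smul_mem _ _ hN.mem)
    have hDM : im D ⟂ im M := by
      rw [Submodule.isOrtho_comm, Submodule.isOrtho_iff_le]
      intro u hu
      rw [← sub_add_cancel u (⟪x, u⟫_ℂ • x), hD]
      refine Submodule.add_mem _ ?_ (Submodule.smul_mem _ _ ?_)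
      · exact Submodule.orthogonal_le inf_le_right
          (Submodule.le_orthogonal_orthogonal _ (hM.sub_mem u hu))
      · exact Submodule.orthogonal_le inf_le_left hN.orthogonal
    intro u hu
    exact ⟨(im_le_iff hφ ho _ _).2 hMN hu.1,
      mem_orthogonal_of_sup hφ ho hAB.1 hD hu.2 (((ho _ _).1 hDM).ge hu.1)⟩
  rw [hMt, hNs] at hle ⊢
  refine Submodule.eq_of_le_of_finrank_eq hle ?_
  rw [finrank_span_singleton, finrank_span_singleton]
  · rintro rfl; simp at hs
  · rintro rfl; simp at ht

theorem increment_eq (hφ : Function.Surjective φ)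
    (ho : ∀ P Q, im P ⟂ im Q ↔ im (φ P) ⟂ im (φ Q)) {A M B N : ProjInf H} {x : H} (hx : ‖x‖ = 1)
    (hM : IsAdjoin A x M) (hN : IsAdjoin B x N) :
    im (φ M) ⊓ (im (φ A))ᗮ = im (φ N) ⊓ (im (φ B))ᗮ := by
  obtain ⟨A₀, B₀, C, hC, h1, h2, h3, h4⟩ := exists_chain A B hM.orthogonal hN.orthogonal
  obtain ⟨M₀, hM₀⟩ := exists_isAdjoin hx (Submodule.orthogonal_le h1.1 hM.orthogonal)
  obtain ⟨N₀, hN₀⟩ := exists_isAdjoin hx (Submodule.orthogonal_le h4.1 hN.orthogonal)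
  obtain ⟨L, hL⟩ := exists_isAdjoin hx hC
  rw [← increment_eq_of_le hφ ho hx hM₀ hM h1, increment_eq_of_le hφ ho hx hM₀ hL h2,
    ← increment_eq_of_le hφ ho hx hN₀ hL h3, increment_eq_of_le hφ ho hx hN₀ hN h4]

/-- The point map on unit vectors induced by `φ`. -/
theorem exists_unit_map (hH : ¬ FiniteDimensional ℂ H) (hφ : Function.Surjective φ)
    (ho : ∀ P Q, im P ⟂ im Q ↔ im (φ P) ⟂ im (φ Q)) {x : H} (hx : ‖x‖ = 1) :
    ∃ t : H, ‖t‖ = 1 ∧ ∀ A M, IsAdjoin A x M → im (φ M) ⊓ (im (φ A))ᗮ = ℂ ∙ t := by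
  obtain ⟨A, -, -, hA, -⟩ := exists_orthogonal_pair hH x x
  obtain ⟨M, hM⟩ := exists_isAdjoin hx hA
  obtain ⟨t, ht, hMt⟩ := exists_span_eq_increment hφ ho hx hM
  exact ⟨t, ht, fun B N hN => (increment_eq hφ ho hx hN hM).trans hMt⟩

/-- Adjoining $x$ to the complement of $P$ shows that $t$ is orthogonal to $\phi(P)^\perp$. -/
theorem mem_im_of_increment (hφ : Function.Surjective φ)
    (ho : ∀ P Q, im P ⟂ im Q ↔ im (φ P) ⟂ im (φ Q)) {x t : H} (hx : ‖x‖ = 1)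
    (h : ∀ A M, IsAdjoin A x M → im (φ M) ⊓ (im (φ A))ᗮ = ℂ ∙ t) {P : ProjInf H}
    (hP : x ∈ im P) : t ∈ im (φ P) := by
  obtain ⟨A, hA⟩ := exists_im_eq_orthogonal P
  obtain ⟨M, hM⟩ := exists_isAdjoin (A := A) hx
    (by rwa [hA, Submodule.orthogonal_orthogonal])
  have := (h A M hM ▸ Submodule.mem_span_singleton_self t : t ∈ im (φ M) ⊓ (im (φ A))ᗮ).2
  rwa [im_compl hφ ho hA, SetLike.mem_coe, Submodule.orthogonal_orthogonal] at this

theorem sub_mem_of_increment (hφ : Function.Surjective φ)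
    (ho : ∀ P Q, im P ⟂ im Q ↔ im (φ P) ⟂ im (φ Q)) {A M : ProjInf H} {x t : H}
    (hM : IsAdjoin A x M) (ht : ‖t‖ = 1) (h : im (φ M) ⊓ (im (φ A))ᗮ = ℂ ∙ t) {u : H}
    (hu : u ∈ im (φ M)) : u - ⟪t, u⟫_ℂ • t ∈ im (φ A) := by
  have htt : ⟪t, t⟫_ℂ = 1 := by simp [inner_self_eq_norm_sq_to_K, ht]
  have htA : t ∈ (im (φ A))ᗮ :=
    (h ▸ Submodule.mem_span_singleton_self t : t ∈ im (φ M) ⊓ (im (φ A))ᗮ).2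
  have h1 : u - (im (φ A)).starProjection u ∈ ℂ ∙ t := h ▸
    ⟨Submodule.sub_mem _ hu ((im_le_iff hφ ho A M).2 hM.le (Submodule.starProjection_apply_mem _ _)),
      Submodule.sub_starProjection_mem_orthogonal _⟩
  obtain ⟨c, hc⟩ := Submodule.mem_span_singleton.1 h1
  have h2 : c = ⟪t, u⟫_ℂ := by
    have := congrArg (fun z => ⟪t, z⟫_ℂ) hc
    simp only [inner_smul_right, htt, inner_sub_right,
      Submodule.inner_left_of_mem_orthogonal (Submodule.starProjection_apply_mem _ u) htA] at this
    simpa using this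
  rw [← h2, hc, sub_sub_cancel]
  exact Submodule.starProjection_apply_mem _ _

theorem norm_inner_eq_of_increment (hH : ¬ FiniteDimensional ℂ H) (hφ : Function.Surjective φ)
    (hangle : ∀ P Q : ProjInf H,
      infAngle (P : H →L[ℂ] H) (Q : H →L[ℂ] H) = infAngle (φ P : H →L[ℂ] H) (φ Q : H →L[ℂ] H))
    (ho : ∀ P Q, im P ⟂ im Q ↔ im (φ P) ⟂ im (φ Q)) {x y t s : H} (hx : ‖x‖ = 1) (hy : ‖y‖ = 1)
    (ht : ‖t‖ = 1) (hs : ‖s‖ = 1)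
    (hxt : ∀ A M, IsAdjoin A x M → im (φ M) ⊓ (im (φ A))ᗮ = ℂ ∙ t)
    (hys : ∀ A M, IsAdjoin A y M → im (φ M) ⊓ (im (φ A))ᗮ = ℂ ∙ s) :
    ‖⟪t, s⟫_ℂ‖ = ‖⟪x, y⟫_ℂ‖ := by
  obtain ⟨A, B, hAB, hxA, hyA, hxB, hyB⟩ := exists_orthogonal_pair hH x y
  obtain ⟨M, hM⟩ := exists_isAdjoin hx hxA
  obtain ⟨N, hN⟩ := exists_isAdjoin hy hyB
  have hMB : im M ⟂ im B := by
    rw [Submodule.isOrtho_iff_le]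
    intro u hu
    rw [← sub_add_cancel u (⟪x, u⟫_ℂ • x)]
    exact Submodule.add_mem _ (hAB.le (hM.sub_mem u hu)) (Submodule.smul_mem _ _ hxB)
  have hNA : im N ⟂ im A := by
    rw [Submodule.isOrtho_iff_le]
    intro u hu
    rw [← sub_add_cancel u (⟪y, u⟫_ℂ • y)]
    exact Submodule.add_mem _ (hAB.ge (hN.sub_mem u hu)) (Submodule.smul_mem _ _ hyA)
  have htM : t ∈ im (φ M) := mem_im_of_increment hφ ho hx hxt hM.mem
  have hsN : s ∈ im (φ N) := mem_im_of_increment hφ ho hy hys hN.mem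
  have h1 := infAngle_eq_arccos hM.mem hN.mem hx hy fun u hu v hv =>
    inner_eq_of_orthogonal_remainders hAB hyA hxB (hM.sub_mem u hu) (hN.sub_mem v hv)
  have h2 := infAngle_eq_arccos htM hsN ht hs fun u hu v hv =>
    inner_eq_of_orthogonal_remainders ((ho _ _).1 hAB) (((ho _ _).1 hNA).le hsN)
      (((ho _ _).1 hMB).le htM) (sub_mem_of_increment hφ ho hM ht (hxt A M hM) hu)
      (sub_mem_of_increment hφ ho hN hs (hys B N hN) hv)
  rw [hangle, h2] at h1
  have hb : ∀ a b : H, ‖a‖ = 1 → ‖b‖ = 1 → ‖⟪a, b⟫_ℂ‖ ∈ Set.Icc (-1 : ℝ) 1 := fun a b ha hb =>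
    ⟨by linarith [norm_nonneg ⟪a, b⟫_ℂ], by simpa [ha, hb] using norm_inner_le_norm (𝕜 := ℂ) a b⟩
  exact Real.arccos_injOn (hb t s ht hs) (hb x y hx hy) h1

/-- The Wigner map induced by `φ`. -/
theorem exists_vector_map (hH : ¬ FiniteDimensional ℂ H) (hφ : Function.Surjective φ)
    (hangle : ∀ P Q : ProjInf H,
      infAngle (P : H →L[ℂ] H) (Q : H →L[ℂ] H) = infAngle (φ P : H →L[ℂ] H) (φ Q : H →L[ℂ] H)) :
    ∃ T : H → H, (∀ x y, ‖⟪T x, T y⟫_ℂ‖ = ‖⟪x, y⟫_ℂ‖) ∧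
      ∀ P x, x ∈ im P → T x ∈ im (φ P) := by
  have ho : ∀ P Q, im P ⟂ im Q ↔ im (φ P) ⟂ im (φ Q) := fun P Q => by
    rw [← infAngle_eq_pi_div_two_iff, ← infAngle_eq_pi_div_two_iff, hangle]
  have h1 : ∀ x : H, ‖x‖ = 1 → ∃ t : H, ‖t‖ = 1 ∧ ∀ A M, IsAdjoin A x M →
      im (φ M) ⊓ (im (φ A))ᗮ = ℂ ∙ t := fun x hx => exists_unit_map hH hφ ho hx
  choose! f hf1 hf using h1
  -- Extension from the unit sphere by positive homogeneity; the factor $\|x\|$ sends $0$ to $0$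
  -- whatever value `f` takes there.
  refine ⟨fun x => (‖x‖ : ℂ) • f (((‖x‖ : ℂ)⁻¹) • x), fun x y => ?_, fun P x hx => ?_⟩
  · rcases eq_or_ne x 0 with rfl | hx0
    · simp
    rcases eq_or_ne y 0 with rfl | hy0
    · simp
    have hx1 := norm_smul_inv_norm (𝕜 := ℂ) hx0
    have hy1 := norm_smul_inv_norm (𝕜 := ℂ) hy0
    have h := norm_inner_eq_of_increment hH hφ hangle ho hx1 hy1 (hf1 _ hx1) (hf1 _ hy1)
      (hf _ hx1) (hf _ hy1)
    simp only [inner_smul_left, inner_smul_right, norm_mul, RCLike.norm_conj, norm_inv,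
      Complex.norm_real, norm_norm, RCLike.norm_ofReal, abs_norm] at h ⊢
    simp only [Complex.coe_algebraMap] at h ⊢
    rw [h]
    have hx2 : ‖x‖ ≠ 0 := by simpa using hx0
    have hy2 : ‖y‖ ≠ 0 := by simpa using hy0
    field_simp
  · rcases eq_or_ne x 0 with rfl | hx0
    · simp
    · have hx1 := norm_smul_inv_norm (𝕜 := ℂ) hx0
      exact Submodule.smul_mem _ _
        (mem_im_of_increment hφ ho hx1 (hf _ hx1) (Submodule.smul_mem _ _ hx))

end ProjInf

end AnglePreserving

/-! ### Wigner's theorem for maps not assumed surjective. -/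

section Wigner

variable {F G : Type*} [NormedAddCommGroup F] [InnerProductSpace ℂ F]
  [NormedAddCommGroup G] [InnerProductSpace ℂ G]

theorem norm_add_smul_add_smul_sq (x y z : F) (a b : ℝ) :
    ‖x + (a : ℂ) • y + (b : ℂ) • z‖ ^ 2 = (⟪x, x⟫_ℂ).re + a ^ 2 * (⟪y, y⟫_ℂ).re +
      b ^ 2 * (⟪z, z⟫_ℂ).re + 2 * a * (⟪x, y⟫_ℂ).re + 2 * b * (⟪x, z⟫_ℂ).re +
      2 * a * b * (⟪y, z⟫_ℂ).re := by
  rw [@norm_sq_eq_re_inner ℂ]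
  simp only [inner_add_left, inner_add_right, inner_smul_left, inner_smul_right, Complex.conj_ofReal,
    RCLike.re_eq_complex_re, Complex.add_re, Complex.re_ofReal_mul]
  have h1 : (⟪y, x⟫_ℂ).re = (⟪x, y⟫_ℂ).re := inner_re_symm (𝕜 := ℂ) y x
  have h2 : (⟪z, x⟫_ℂ).re = (⟪x, z⟫_ℂ).re := inner_re_symm (𝕜 := ℂ) z x
  have h3 : (⟪z, y⟫_ℂ).re = (⟪y, z⟫_ℂ).re := inner_re_symm (𝕜 := ℂ) z y
  rw [h1, h2, h3]
  ring

theorem Complex.smul_eq_re_smul_add_im_smul (c : ℂ) (x : F) :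
    c • x = (c.re : ℂ) • x + (c.im : ℂ) • (Complex.I • x) := by
  rw [smul_smul, ← add_smul, Complex.re_add_im]

variable {V : F → G}

/-- The squared norm of a real combination involves only real parts of inner products. The defect of
real linearity thus has the norm of the same combination upstairs, which is zero. -/
theorem map_add_smul_of_re_inner (hre : ∀ x y, (⟪V x, V y⟫_ℂ).re = (⟪x, y⟫_ℂ).re)
    (a b : ℝ) (y z : F) :
    V ((a : ℂ) • y + (b : ℂ) • z) = (a : ℂ) • V y + (b : ℂ) • V z := by
  have h1 := norm_add_smul_add_smul_sq (V ((a : ℂ) • y + (b : ℂ) • z)) (V y) (V z) (-a) (-b)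
  simp only [hre] at h1
  rw [← norm_add_smul_add_smul_sq] at h1
  have h0 : (a : ℂ) • y + (b : ℂ) • z + ((-a : ℝ) : ℂ) • y + ((-b : ℝ) : ℂ) • z = 0 := by
    push_cast
    module
  rw [h0, norm_zero, zero_pow two_ne_zero, sq_eq_zero_iff, norm_eq_zero] at h1
  push_cast at h1
  rw [← sub_eq_zero, ← h1]
  module

theorem map_add_of_re_inner (hre : ∀ x y, (⟪V x, V y⟫_ℂ).re = (⟪x, y⟫_ℂ).re) (y z : F) :
    V (y + z) = V y + V z := by
  simpa using map_add_smul_of_re_inner hre 1 1 y z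

theorem map_ofReal_smul_of_re_inner (hre : ∀ x y, (⟪V x, V y⟫_ℂ).re = (⟪x, y⟫_ℂ).re) (a : ℝ)
    (y : F) : V ((a : ℂ) • y) = (a : ℂ) • V y := by
  simpa using map_add_smul_of_re_inner hre a 0 y y

/-- $\langle Vz,V(iz)\rangle$ has real part $0$ and modulus $\|z\|^2$, so it is $\pm i\|z\|^2$, the
equality case of Cauchy–Schwarz. -/
theorem map_I_smul_of_inner (hre : ∀ x y, (⟪V x, V y⟫_ℂ).re = (⟪x, y⟫_ℂ).re)
    (hn : ∀ x y, ‖⟪V x, V y⟫_ℂ‖ = ‖⟪x, y⟫_ℂ‖) (z : F) :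
    V (Complex.I • z) = Complex.I • V z ∨ V (Complex.I • z) = -Complex.I • V z := by
  have hz : ⟪z, z⟫_ℂ = ((‖z‖ ^ 2 : ℝ) : ℂ) := by
    rw [inner_self_eq_norm_sq_to_K]; norm_cast
  have hself : ∀ x, ‖V x‖ = ‖x‖ := fun x => by
    have := hre x x
    rw [← RCLike.re_eq_complex_re, inner_self_eq_norm_sq, inner_self_eq_norm_sq] at this
    exact (sq_eq_sq₀ (norm_nonneg _) (norm_nonneg _)).1 this
  have h1 : (⟪V z, V (Complex.I • z)⟫_ℂ).re = 0 := by
    rw [hre, inner_smul_right, hz, mul_comm, Complex.re_ofReal_mul, Complex.I_re, mul_zero]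
  have h2 : (⟪V z, V (Complex.I • z)⟫_ℂ).im ^ 2 = (‖z‖ ^ 2) ^ 2 := by
    have := congrArg (· ^ 2) (hn z (Complex.I • z))
    simp only [inner_smul_right, hz, norm_mul, Complex.norm_I, one_mul, Complex.norm_real,
      Real.norm_eq_abs, sq_abs] at this
    rw [← Complex.normSq_eq_norm_sq, Complex.normSq_apply, h1] at this
    linarith
  have key : ∀ ε : ℝ, ε ^ 2 = 1 → (⟪V z, V (Complex.I • z)⟫_ℂ).im = ε * ‖z‖ ^ 2 →
      V (Complex.I • z) = ((ε : ℂ) * Complex.I) • V z := by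
    intro ε hε h
    rw [← sub_eq_zero, ← norm_eq_zero, ← sq_eq_zero_iff, @norm_sub_sq ℂ, norm_smul, hself, hself,
      norm_smul, ← inner_conj_symm, RCLike.conj_re, inner_smul_left]
    simp only [Complex.norm_I, one_mul, norm_mul, Complex.norm_real, mul_one, map_mul,
      Complex.conj_ofReal, Complex.conj_I, RCLike.re_eq_complex_re]
    have : ((ε : ℂ) * -Complex.I * ⟪V z, V (Complex.I • z)⟫_ℂ).re = ‖z‖ ^ 2 := by
      simp only [Complex.mul_re, Complex.mul_im, Complex.neg_re, Complex.neg_im, Complex.I_re,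
        Complex.I_im, Complex.ofReal_re, Complex.ofReal_im, h, h1]
      linear_combination ‖z‖ ^ 2 * hε
    rw [this, mul_pow, Real.norm_eq_abs, sq_abs, hε]
    ring
  rcases sq_eq_sq_iff_eq_or_eq_neg.1 h2 with h | h
  · left
    simpa using key 1 (by norm_num) (by linarith)
  · right
    simpa using key (-1) (by norm_num) (by linarith)

/-- A map preserving real parts and absolute values of inner products is a linear or a conjugate
linear isometry. -/
theorem exists_linearIsometry_of_inner (hre : ∀ x y, (⟪V x, V y⟫_ℂ).re = (⟪x, y⟫_ℂ).re)
    (hn : ∀ x y, ‖⟪V x, V y⟫_ℂ‖ = ‖⟪x, y⟫_ℂ‖) :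
    (∃ L : F →ₗᵢ[ℂ] G, ∀ x, L x = V x) ∨ ∃ L : F →ₛₗᵢ[starRingEnd ℂ] G, ∀ x, L x = V x := by
  have hself : ∀ x, ‖V x‖ = ‖x‖ := fun x => by
    have := hre x x
    rw [← RCLike.re_eq_complex_re, inner_self_eq_norm_sq, inner_self_eq_norm_sq] at this
    exact (sq_eq_sq₀ (norm_nonneg _) (norm_nonneg _)).1 this
  have hadd := map_add_of_re_inner hre
  have hreal := map_ofReal_smul_of_re_inner hre
  have hcases : (∀ x, V (Complex.I • x) = Complex.I • V x) ∨
      ∀ x, V (Complex.I • x) = -Complex.I • V x := by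
    by_contra! h
    obtain ⟨⟨x, hx⟩, y, hy⟩ := h
    have hx' := (map_I_smul_of_inner hre hn x).resolve_left hx
    have hy' := (map_I_smul_of_inner hre hn y).resolve_right hy
    have h2 : (2 * Complex.I) ≠ 0 := by simp
    -- If $x$ and $y$ had opposite signs, either sign at $x+y$ would force $Vx=0$ or $Vy=0$, where
    -- both signs hold.
    have hxy := map_I_smul_of_inner hre hn (x + y)
    rw [smul_add, hadd, hadd, hx', hy'] at hxy
    rcases hxy with h | h
    · have h3 : (2 * Complex.I) • V x = 0 := by
        rw [← sub_eq_zero] at h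
        rw [← neg_eq_zero, ← h]
        module
      apply hx
      rw [hx', (smul_eq_zero.1 h3).resolve_left h2, smul_zero, smul_zero]
    · have h3 : (2 * Complex.I) • V y = 0 := by
        rw [← sub_eq_zero] at h
        rw [← h]
        module
      apply hy
      rw [hy', (smul_eq_zero.1 h3).resolve_left h2, smul_zero, smul_zero]
  rcases hcases with h | h
  · left
    refine ⟨⟨⟨⟨V, hadd⟩, fun c x => ?_⟩, hself⟩, fun x => rfl⟩
    change V (c • x) = c • V x
    rw [Complex.smul_eq_re_smul_add_im_smul c x, hadd, hreal, hreal, h, ← Complex.smul_eq_re_smul_add_im_smul]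
  · right
    refine ⟨⟨⟨⟨V, hadd⟩, fun c x => ?_⟩, hself⟩, fun x => rfl⟩
    change V (c • x) = (starRingEnd ℂ c) • V x
    rw [Complex.smul_eq_re_smul_add_im_smul c x, hadd, hreal, hreal, h, Complex.smul_eq_re_smul_add_im_smul (starRingEnd ℂ c)]
    simp

variable {H : Type*} [NormedAddCommGroup H] [InnerProductSpace ℂ H] {T : H → H}

theorem norm_map_of_norm_inner (hT : ∀ x y, ‖⟪T x, T y⟫_ℂ‖ = ‖⟪x, y⟫_ℂ‖) (x : H) :
    ‖T x‖ = ‖x‖ := by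
  have := hT x x
  simp only [inner_self_eq_norm_sq_to_K, norm_pow] at this
  exact (sq_eq_sq₀ (norm_nonneg _) (norm_nonneg _)).1 (by simpa using this)

theorem mem_span_map_smul (hT : ∀ x y, ‖⟪T x, T y⟫_ℂ‖ = ‖⟪x, y⟫_ℂ‖) {c : ℂ} (hc : c ≠ 0)
    (x : H) : T x ∈ ℂ ∙ T (c • x) := by
  have hn := norm_map_of_norm_inner hT
  rcases eq_or_ne x 0 with rfl | hx
  · have : T 0 = 0 := by rw [← norm_eq_zero, hn, norm_zero]
    simp [this]
  have h1 : T (c • x) ≠ 0 := by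
    rw [← norm_ne_zero_iff, hn, norm_ne_zero_iff]
    exact smul_ne_zero hc hx
  have h2 : T x ≠ 0 := by rwa [← norm_ne_zero_iff, hn, norm_ne_zero_iff]
  have h3 : ‖⟪T (c • x), T x⟫_ℂ‖ = ‖T (c • x)‖ * ‖T x‖ := by
    rw [hT, hn, hn, inner_smul_left, norm_mul, norm_smul, RCLike.norm_conj,
      inner_self_eq_norm_sq_to_K]
    simp
    ring
  obtain ⟨r, -, hr⟩ := (norm_inner_eq_norm_iff h1 h2).1 h3
  rw [hr]
  exact Submodule.smul_mem _ _ (Submodule.mem_span_singleton_self _)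

/-- Phase normalisation of a Wigner map relative to a unit vector. -/
theorem exists_phase_normalisation (hT : ∀ x y, ‖⟪T x, T y⟫_ℂ‖ = ‖⟪x, y⟫_ℂ‖) {e : H}
    (he : ‖e‖ = 1) {z : H} (hz : ⟪e, z⟫_ℂ = 0) :
    ∃ v : H, ⟪T e, v⟫_ℂ = 0 ∧ (∃ c : ℂ, ‖c‖ = 1 ∧ T e + v = c • T (e + z)) ∧
      ∃ d : ℂ, ‖d‖ = 1 ∧ v = d • T z := by
  have hn := norm_map_of_norm_inner hT
  have hee : ⟪e, e⟫_ℂ = 1 := by simp [inner_self_eq_norm_sq_to_K, he]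
  have hTe : ⟪T e, T e⟫_ℂ = 1 := by simp [inner_self_eq_norm_sq_to_K, hn, he]
  have h1 : ‖⟪T e, T (e + z)⟫_ℂ‖ = 1 := by rw [hT, inner_add_right, hz, hee]; simp
  have h0 : ⟪T e, T (e + z)⟫_ℂ ≠ 0 := by rw [← norm_ne_zero_iff, h1]; exact one_ne_zero
  -- This phase makes the component of $cT(e+z)$ along $Te$ exactly $Te$; `v` is the remainder.
  obtain ⟨c, hc⟩ : ∃ c : ℂ, c = (⟪T e, T (e + z)⟫_ℂ)⁻¹ := ⟨_, rfl⟩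
  have hc1 : ‖c‖ = 1 := by rw [hc, norm_inv, h1, inv_one]
  have hv0 : ⟪T e, c • T (e + z) - T e⟫_ℂ = 0 := by
    rw [inner_sub_right, inner_smul_right, hTe, hc, inv_mul_cancel₀ h0, sub_self]
  refine ⟨c • T (e + z) - T e, hv0, ⟨c, hc1, by abel⟩, ?_⟩
  have hvn : ‖c • T (e + z) - T e‖ = ‖z‖ := by
    have h2 : ‖T e + (c • T (e + z) - T e)‖ = ‖e + z‖ := by
      rw [add_sub_cancel, norm_smul, hc1, hn, one_mul]
    have h3 := norm_add_sq_eq_norm_sq_add_norm_sq_of_inner_eq_zero _ _ hv0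
    have h4 := norm_add_sq_eq_norm_sq_add_norm_sq_of_inner_eq_zero _ _ hz
    rw [h2, h4, hn] at h3
    nlinarith [norm_nonneg z, norm_nonneg (c • T (e + z) - T e)]
  rcases eq_or_ne z 0 with rfl | hz0
  · refine ⟨1, norm_one, ?_⟩
    rw [norm_zero, norm_eq_zero] at hvn
    have : T 0 = 0 := by rw [← norm_eq_zero, hn, norm_zero]
    rw [hvn, this, smul_zero]
  have hTz : T z ≠ 0 := by rwa [← norm_ne_zero_iff, hn, norm_ne_zero_iff]
  have hv : c • T (e + z) - T e ≠ 0 := by rwa [← norm_ne_zero_iff, hvn, norm_ne_zero_iff]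
  have hzTe : ⟪T z, T e⟫_ℂ = 0 := by
    rw [← norm_eq_zero, hT, norm_eq_zero]
    exact inner_eq_zero_symm.1 hz
  have h5 : ‖⟪T z, c • T (e + z) - T e⟫_ℂ‖ = ‖T z‖ * ‖c • T (e + z) - T e‖ := by
    rw [inner_sub_right, hzTe, sub_zero, inner_smul_right, norm_mul, hc1, hT, hvn, hn,
      inner_add_right, inner_eq_zero_symm.1 hz, zero_add, inner_self_eq_norm_sq_to_K]
    simp
    ring
  obtain ⟨d, -, hd⟩ := (norm_inner_eq_norm_iff hTz hv).1 h5
  refine ⟨d, ?_, hd⟩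
  rw [hd, norm_smul, hn] at hvn
  exact mul_right_cancel₀ (norm_ne_zero_iff.2 hz0) (hvn.trans (one_mul _).symm)

/-- Extension of an isometry from the complement of a unit vector. -/
theorem exists_extension_of_phase_normalisation {σ : ℂ →+* ℂ} (hσ : ∀ c, ‖σ c‖ = ‖c‖)
    (hT : ∀ x y, ‖⟪T x, T y⟫_ℂ‖ = ‖⟪x, y⟫_ℂ‖) {e : H} (he : ‖e‖ = 1)
    (L : ((ℂ ∙ e)ᗮ : Submodule ℂ H) →ₛₗᵢ[σ] H) (hL : ∀ z, ⟪T e, L z⟫_ℂ = 0)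
    (hL1 : ∀ z : ((ℂ ∙ e)ᗮ : Submodule ℂ H), T e + L z ∈ ℂ ∙ T (e + z))
    (hL2 : ∀ z : ((ℂ ∙ e)ᗮ : Submodule ℂ H), L z ∈ ℂ ∙ T z) :
    ∃ U : H →ₛₗᵢ[σ] H, ∀ x, U x ∈ ℂ ∙ T x := by
  have hn := norm_map_of_norm_inner hT
  let p := (ℂ ∙ e)ᗮ.orthogonalProjectionOnto
  have hp : ∀ x, x = ⟪e, x⟫_ℂ • e + p x := by
    intro x
    have := (ℂ ∙ e).starProjection_add_starProjection_orthogonal x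
    rw [Submodule.starProjection_unit_singleton ℂ he] at this
    exact this.symm
  let U₀ : H →ₛₗ[σ] H :=
    { toFun := fun x => σ ⟪e, x⟫_ℂ • T e + L (p x)
      map_add' := fun x y => by
        simp only [inner_add_right, map_add, add_smul]; abel
      map_smul' := fun c x => by
        simp only [inner_smul_right, map_mul, map_smul, LinearIsometry.map_smulₛₗ, smul_add,
          mul_smul] }
  refine ⟨⟨U₀, fun x => ?_⟩, fun x => ?_⟩
  · have h1 : ‖U₀ x‖ ^ 2 = ‖x‖ ^ 2 := by
      have ha : ⟪σ ⟪e, x⟫_ℂ • T e, L (p x)⟫_ℂ = 0 := by rw [inner_smul_left, hL, mul_zero]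
      have hb : ⟪⟪e, x⟫_ℂ • e, (p x : H)⟫_ℂ = 0 := by
        rw [inner_smul_left, Submodule.mem_orthogonal_singleton_iff_inner_right.1 (p x).2, mul_zero]
      have h3 := norm_add_sq_eq_norm_sq_add_norm_sq_of_inner_eq_zero _ _ ha
      have h4 := norm_add_sq_eq_norm_sq_add_norm_sq_of_inner_eq_zero _ _ hb
      rw [← hp x] at h4
      rw [norm_smul, hσ, hn, L.norm_map] at h3
      rw [norm_smul] at h4
      rw [sq, sq, h4]
      exact h3
    exact (sq_eq_sq₀ (norm_nonneg _) (norm_nonneg _)).1 h1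
  · change σ ⟪e, x⟫_ℂ • T e + L (p x) ∈ ℂ ∙ T x
    have hx := hp x
    by_cases h0 : ⟪e, x⟫_ℂ = 0
    · rw [h0, zero_smul, zero_add] at hx
      rw [h0, map_zero, zero_smul, zero_add]
      have := hL2 (p x)
      rwa [← hx] at this
    · generalize ⟪e, x⟫_ℂ = c at h0 hx
      -- For $c\ne0$, $x=c(e+c^{-1}px)$, which reduces to the normalised vectors $e+z$.
      have hpc : p x = c • c⁻¹ • p x := by rw [smul_inv_smul₀ h0]
      rw [hpc, LinearIsometry.map_smulₛₗ, ← smul_add]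
      refine Submodule.smul_mem _ _ ?_
      have h1 := hL1 (c⁻¹ • p x)
      have h2 := mem_span_map_smul hT h0 (e + ((c⁻¹ • p x : ((ℂ ∙ e)ᗮ : Submodule ℂ H)) : H))
      have h3 : c • (e + ((c⁻¹ • p x : ((ℂ ∙ e)ᗮ : Submodule ℂ H)) : H)) = x := by
        rw [Submodule.coe_smul, smul_add, smul_inv_smul₀ h0, ← hx]
      rw [h3] at h2
      exact (Submodule.span_singleton_le_iff_mem _ _).2 h2 h1

/-- **Wigner's theorem**: a map preserving absolute values of inner products is, up to phases, a
linear or conjugate linear isometry. -/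
theorem wigner (hT : ∀ x y, ‖⟪T x, T y⟫_ℂ‖ = ‖⟪x, y⟫_ℂ‖) {e : H} (he : ‖e‖ = 1) :
    (∃ U : H →ₗᵢ[ℂ] H, ∀ x, U x ∈ ℂ ∙ T x) ∨
      ∃ U : H →ₛₗᵢ[starRingEnd ℂ] H, ∀ x, U x ∈ ℂ ∙ T x := by
  have hn := norm_map_of_norm_inner hT
  have hee : ⟪e, e⟫_ℂ = 1 := by simp [inner_self_eq_norm_sq_to_K, he]
  have hTe : ⟪T e, T e⟫_ℂ = 1 := by simp [inner_self_eq_norm_sq_to_K, hn, he]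
  have hK : ∀ z : ((ℂ ∙ e)ᗮ : Submodule ℂ H), ⟪e, (z : H)⟫_ℂ = 0 := fun z =>
    Submodule.mem_orthogonal_singleton_iff_inner_right.1 z.2
  choose V hV0 hV1 hV2 using fun z => exists_phase_normalisation hT he (hK z)
  have hnorm : ∀ z w, ‖⟪V z, V w⟫_ℂ‖ = ‖⟪z, w⟫_ℂ‖ := by
    intro z w
    obtain ⟨d, hd, hz⟩ := hV2 z
    obtain ⟨d', hd', hw⟩ := hV2 w
    rw [hz, hw, inner_smul_left, inner_smul_right, norm_mul, norm_mul, RCLike.norm_conj, hd, hd',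
      one_mul, one_mul, hT, Submodule.coe_inner]
  have hre : ∀ z w, (⟪V z, V w⟫_ℂ).re = (⟪z, w⟫_ℂ).re := by
    intro z w
    -- The moduli of $a$ and $1+a$ together determine $\operatorname{Re}a$.
    have h1 : ‖1 + ⟪V z, V w⟫_ℂ‖ = ‖1 + ⟪z, w⟫_ℂ‖ := by
      obtain ⟨c, hc, hz⟩ := hV1 z
      obtain ⟨c', hc', hw⟩ := hV1 w
      have ha : ⟪T e + V z, T e + V w⟫_ℂ = 1 + ⟪V z, V w⟫_ℂ := by
        simp only [inner_add_left, inner_add_right, hTe, hV0, inner_eq_zero_symm.1 (hV0 z)]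
        ring
      have hb : ⟪e + (z : H), e + (w : H)⟫_ℂ = 1 + ⟪z, w⟫_ℂ := by
        simp only [inner_add_left, inner_add_right, hee, hK, inner_eq_zero_symm.1 (hK z),
          Submodule.coe_inner]
        ring
      rw [← ha, ← hb, hz, hw, inner_smul_left, inner_smul_right, norm_mul, norm_mul,
        RCLike.norm_conj, hc, hc', one_mul, one_mul, hT]
    have h2 := congrArg (· ^ 2) h1
    have h3 := congrArg (· ^ 2) (hnorm z w)
    simp only [← Complex.normSq_eq_norm_sq, Complex.normSq_apply, Complex.add_re, Complex.add_im,
      Complex.one_re, Complex.one_im] at h2 h3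
    linarith
  have hmem1 : ∀ z : ((ℂ ∙ e)ᗮ : Submodule ℂ H), T e + V z ∈ ℂ ∙ T (e + z) := fun z => by
    obtain ⟨c, -, hc⟩ := hV1 z
    exact hc ▸ Submodule.smul_mem _ _ (Submodule.mem_span_singleton_self _)
  have hmem2 : ∀ z : ((ℂ ∙ e)ᗮ : Submodule ℂ H), V z ∈ ℂ ∙ T z := fun z => by
    obtain ⟨d, -, hd⟩ := hV2 z
    exact hd ▸ Submodule.smul_mem _ _ (Submodule.mem_span_singleton_self _)
  rcases exists_linearIsometry_of_inner hre hnorm with ⟨L, hL⟩ | ⟨L, hL⟩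
  · exact Or.inl (exists_extension_of_phase_normalisation (fun c => rfl) hT he L
      (fun z => hL z ▸ hV0 z) (fun z => hL z ▸ hmem1 z) fun z => hL z ▸ hmem2 z)
  · exact Or.inr (exists_extension_of_phase_normalisation (fun c => RCLike.norm_conj c) hT he L
      (fun z => hL z ▸ hV0 z) (fun z => hL z ▸ hmem1 z) fun z => hL z ▸ hmem2 z)

/-- Polarisation: conjugate linearity exchanges the two terms carrying $\pm i$. -/
theorem inner_map_map_of_conjLinearIsometry (U : H →ₛₗᵢ[starRingEnd ℂ] H) (x y : H) :
    ⟪U x, U y⟫_ℂ = ⟪y, x⟫_ℂ := by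
  have hI : ∀ a b : H, U a + Complex.I • U b = U (a - Complex.I • b) := fun a b => by
    simp [map_sub, LinearIsometry.map_smulₛₗ]
  have hI' : ∀ a b : H, U a - Complex.I • U b = U (a + Complex.I • b) := fun a b => by
    simp [map_add, LinearIsometry.map_smulₛₗ, sub_eq_add_neg]
  have h1 : ∀ a b : H, ‖a - Complex.I • b‖ = ‖b + Complex.I • a‖ := fun a b => by
    have : a - Complex.I • b = -Complex.I • (b + Complex.I • a) := by
      rw [smul_add, smul_smul]
      simp
      abel
    rw [this, norm_smul]
    simp
  have h2 : ∀ a b : H, ‖a + Complex.I • b‖ = ‖b - Complex.I • a‖ := fun a b => (h1 b a).symm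
  rw [inner_eq_sum_norm_sq_div_four, inner_eq_sum_norm_sq_div_four]
  simp only [RCLike.I_to_complex, hI, hI', ← map_add, ← map_sub, U.norm_map]
  rw [add_comm x y, norm_sub_rev x y, h1 x y, h2 x y]

end Wigner

/-! ### Intertwining with $\phi$ and surjectivity of the isometry. -/

section Conclusion

variable {H : Type*} [NormedAddCommGroup H] [InnerProductSpace ℂ H] [CompleteSpace H]

namespace ProjInf

/-- `U` carries $\operatorname{Im}P$ into $\operatorname{Im}\phi(P)$ and, by `im_compl`, the
complement into the complement, so $UPx$ is the projection of $Ux$. -/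
theorem map_apply_eq_of_mem_span {φ : ProjInf H → ProjInf H} (hφ : Function.Surjective φ)
    (ho : ∀ P Q, im P ⟂ im Q ↔ im (φ P) ⟂ im (φ Q)) {σ : ℂ →+* ℂ} {T : H → H}
    (hT : ∀ P x, x ∈ im P → T x ∈ im (φ P)) (U : H →ₛₗᵢ[σ] H) (hU : ∀ x, U x ∈ ℂ ∙ T x)
    (P : ProjInf H) (x : H) : (φ P : H →L[ℂ] H) (U x) = U ((P : H →L[ℂ] H) x) := by
  have hUP : ∀ P x, x ∈ im P → U x ∈ im (φ P) := fun P x hx =>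
    (Submodule.span_singleton_le_iff_mem _ _).2 (hT P x hx) (hU x)
  obtain ⟨P', hP'⟩ := exists_im_eq_orthogonal P
  rw [coe_eq_starProjection, coe_eq_starProjection]
  refine Submodule.eq_starProjection_of_mem_orthogonal
    (hUP P _ (Submodule.starProjection_apply_mem _ _)) ?_
  rw [← map_sub, ← im_compl hφ ho hP']
  exact hUP P' _ (hP' ▸ Submodule.sub_starProjection_mem_orthogonal _)

/-- A nonzero subspace invariant under all of `P_∞(H)` is the whole space. -/
theorem eq_top_of_invariant (hH : ¬ FiniteDimensional ℂ H) {R : Submodule ℂ H} (hR : R ≠ ⊥)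
    (hinv : ∀ Q : ProjInf H, ∀ v ∈ R, (Q : H →L[ℂ] H) v ∈ R) : R = ⊤ := by
  obtain ⟨r, hr, hr0⟩ := (Submodule.ne_bot_iff _).1 hR
  rw [Submodule.eq_top_iff']
  have key : ∀ w, ⟪r, w⟫_ℂ = 0 → w ∈ R := by
    intro w hw
    have hrm : ⟪r + w, r⟫_ℂ ≠ 0 := by
      rw [inner_add_left, inner_eq_zero_symm.1 hw, add_zero, inner_self_ne_zero]
      exact hr0
    have hm0 : r + w ≠ 0 := fun h => hrm (by rw [h, inner_zero_left])
    -- With $A$ orthogonal to $r+w$ and $r$, the projection of $r$ onto $A\oplus\mathbb{C}(r+w)$ is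
    -- a nonzero multiple of $r+w$; invariance puts $r+w$, hence $w$, in `R`.
    obtain ⟨A, -, -, hmA, hrA, -⟩ := exists_orthogonal_pair hH (r + w) r
    have hm1 := norm_smul_inv_norm (𝕜 := ℂ) hm0
    have hmA' := (im A)ᗮ.smul_mem ((‖r + w‖ : ℂ)⁻¹) hmA
    have hc : ((‖r + w‖ : ℂ)⁻¹) ≠ 0 := by simpa using hm0
    have hrm' : ⟪((‖r + w‖ : ℂ)⁻¹) • (r + w), r⟫_ℂ ≠ 0 := by
      rw [inner_smul_left]
      exact mul_ne_zero ((map_ne_zero _).2 hc) hrm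
    suffices h : ((‖r + w‖ : ℂ)⁻¹) • (r + w) ∈ R by
      rw [Submodule.smul_mem_iff _ hc] at h
      exact (Submodule.add_mem_iff_right _ hr).1 h
    generalize ((‖r + w‖ : ℂ)⁻¹) • (r + w) = m at hm1 hmA' hrm'
    have hmm : ⟪m, m⟫_ℂ = 1 := by simp [inner_self_eq_norm_sq_to_K, hm1]
    obtain ⟨M, hM⟩ := exists_isAdjoin hm1 hmA'
    have h := hinv M r hr
    rw [coe_eq_starProjection, Submodule.eq_starProjection_of_mem_orthogonal
      (Submodule.smul_mem _ ⟪m, r⟫_ℂ hM.mem), Submodule.smul_mem_iff _ hrm'] at h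
    · exact h
    rw [Submodule.mem_orthogonal]
    intro v hv
    rw [← sub_add_cancel v (⟪m, v⟫_ℂ • m), inner_add_left,
      Submodule.inner_right_of_mem_orthogonal (hM.sub_mem v hv)
        (Submodule.sub_mem _ hrA (Submodule.smul_mem _ _ hmA')),
      inner_smul_left, inner_sub_right, inner_smul_right, hmm]
    ring
  intro w
  rw [← sub_add_cancel w ((⟪r, w⟫_ℂ / ⟪r, r⟫_ℂ) • r)]
  refine Submodule.add_mem _ (key _ ?_) (Submodule.smul_mem _ _ hr)
  rw [inner_sub_right, inner_smul_right, div_mul_cancel₀ _ (inner_self_ne_zero.2 hr0), sub_self]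

/-- By the intertwining relation the range of `U` is invariant under every $\phi(P)$, and these
exhaust $P_\infty(H)$. -/
theorem surjective_of_mem_span (hH : ¬ FiniteDimensional ℂ H) {φ : ProjInf H → ProjInf H}
    (hφ : Function.Surjective φ) {σ : ℂ →+* ℂ} [RingHomSurjective σ] (U : H →ₛₗᵢ[σ] H)
    (h : ∀ (P : ProjInf H) x, (φ P : H →L[ℂ] H) (U x) = U ((P : H →L[ℂ] H) x)) {e : H}
    (he : ‖e‖ = 1) : Function.Surjective U := by
  have : LinearMap.range U.toLinearMap = ⊤ := by
    refine eq_top_of_invariant hH ((Submodule.ne_bot_iff _).2 ⟨U e, ⟨e, rfl⟩, ?_⟩) ?_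
    · rw [← norm_ne_zero_iff, U.norm_map, he]
      exact one_ne_zero
    · rintro Q _ ⟨x, rfl⟩
      obtain ⟨P, rfl⟩ := hφ Q
      exact ⟨(P : H →L[ℂ] H) x, (h P x).symm⟩
  exact LinearMap.range_eq_top.1 this

end ProjInf

end Conclusion

theorem proposition1p1 {H : Type*} [NormedAddCommGroup H] [InnerProductSpace ℂ H]
    [CompleteSpace H] [TopologicalSpace.SeparableSpace H] (hH : ¬ FiniteDimensional ℂ H)
    (φ : ProjInf H → ProjInf H) (hφ : Function.Surjective φ)
    (hangle : ∀ P Q : ProjInf H,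
      infAngle (P : H →L[ℂ] H) (Q : H →L[ℂ] H) = infAngle (φ P : H →L[ℂ] H) (φ Q : H →L[ℂ] H)) :
    (∃ U ∈ unitary (H →L[ℂ] H), ∀ P : ProjInf H,
      (φ P : H →L[ℂ] H) = U * (P : H →L[ℂ] H) * star U) ∨
    (∃ U : H →L⋆[ℂ] H, IsAntiunitary U ∧ ∀ P : ProjInf H,
      (φ P : H →L[ℂ] H) = U.comp ((P : H →L[ℂ] H).comp (conjAdjoint U))) := by
  obtain ⟨T, hT, hTP⟩ := ProjInf.exists_vector_map hH hφ hangle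
  have ho : ∀ P Q, ProjInf.im P ⟂ ProjInf.im Q ↔ ProjInf.im (φ P) ⟂ ProjInf.im (φ Q) :=
    fun P Q => by
      rw [← ProjInf.infAngle_eq_pi_div_two_iff, ← ProjInf.infAngle_eq_pi_div_two_iff, hangle]
  obtain ⟨A, -⟩ := ProjInf.exists_orthogonal_pair hH 0 0
  obtain ⟨e, -, he⟩ := ProjInf.exists_unit_mem_im A
  rcases wigner hT he with ⟨U, hU⟩ | ⟨U, hU⟩
  · left
    have hcomm := ProjInf.map_apply_eq_of_mem_span hφ ho hTP U hU
    have hsurj := ProjInf.surjective_of_mem_span hH hφ U hcomm he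
    have hstar : star U.toContinuousLinearMap * U.toContinuousLinearMap = 1 :=
      (ContinuousLinearMap.inner_map_map_iff_adjoint_comp_self _).1 fun x y => U.inner_map_map x y
    have hstar' : ∀ x, star U.toContinuousLinearMap (U x) = x := fun x =>
      congrArg (fun f : H →L[ℂ] H => f x) hstar
    refine ⟨U.toContinuousLinearMap, Unitary.mem_iff.2 ⟨hstar, ?_⟩, fun P => ?_⟩
    · ext y
      obtain ⟨x, rfl⟩ := hsurj y
      exact congrArg U (hstar' x)
    · ext y
      obtain ⟨x, rfl⟩ := hsurj y
      rw [hcomm]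
      exact congrArg (fun z => U ((P : H →L[ℂ] H) z)) (hstar' x).symm
  · right
    have hcomm := ProjInf.map_apply_eq_of_mem_span hφ ho hTP U hU
    have hsurj := ProjInf.surjective_of_mem_span hH hφ U hcomm he
    have hinner := inner_map_map_of_conjLinearIsometry U
    have hadj : ∀ x, conjAdjoint U.toContinuousLinearMap (U x) = x := fun x =>
      ext_inner_right ℂ fun y => by
        rw [inner_conjAdjoint]
        exact hinner y x
    refine ⟨U.toContinuousLinearMap, ⟨hsurj, hinner⟩, fun P => ?_⟩
    ext y
    obtain ⟨x, rfl⟩ := hsurj y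
    rw [hcomm]
    exact congrArg (fun z => U ((P : H →L[ℂ] H) z)) (hadj x).symm
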